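/- For integers $k,\ell\ge 1$ let $P_{k,\ell}$ (the quadrangulated cylinder) be the simple graph with vertex set $\{x_{i,j}: 1\le i\le k,\ 1\le j\le \ell\}$ and edge set $$\{x_{i,j}x_{i+1,j}: 1\le i\le k-1,\ 1\le j\le \ell\}\cup\{x_{i,j+1}x_{i+1,j}: 1\le i\le k-1,\ 1\le j\le \ell,\ i \text{ odd}\}\cup\{x_{i,j}x_{i+1,j+1}: 1\le i\le k-1,\ 1\le j\le \ell,\ i\text{ even}\},$$ where $x_{i,\ell+1}=x_{i,1}$ for all $i$. Let $\mathrm{ex}(n,H)$ be the maximum number of edges of an $n$-vertex simple graph containing no copy of $H$ as a (not necessarily induced) subgraph (and $0$ if every $n$-vertex graph contains $H$). Theorem. For all positive integers $k$ and $\ell$, $\mathrm{ex}(n,P_{k,\ell})=O_{k,\ell}(n^{3/2})$ as $n\to\infty$. If moreover $k\ge 3$ and $\ell\ge 2$, or $k=\ell=2$ (that is, if $P_{k,\ell}$ contains a 4-cycle), then $$\mathrm{ex}(n,P_{k,\ell})=\Theta_{k,\ell}(n^{3/2})\quad\text{as } n\to\infty,$$ where the implied constants depend only on $k$ and $\ell$.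 -/

import Mathlib

open scoped Asymptotics

/-- The quadrangulated cylinder `P_{k,ℓ}`: the vertex `(i, j) : Fin k × Fin ℓ` stands for
`x_{i+1,j+1}`, so that an even `i` here is an odd first index of `x`. The second index is read
cyclically. The edges between two consecutive levels `i`, `i + 1` (numbered from `0`) are
`(i, j) (i + 1, j)`, together with `(i, j + 1) (i + 1, j)` if `i` is even
and `(i, j) (i + 1, j + 1)` if `i` is odd. -/
def quadCylinder (k ℓ : ℕ) : SimpleGraph (Fin k × Fin ℓ) :=
  SimpleGraph.fromRel fun u v =>
    (v.1 : ℕ) = (u.1 : ℕ) + 1 ∧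
      (u.2 = v.2 ∨
        (Even (u.1 : ℕ) ∧ (u.2 : ℕ) = ((v.2 : ℕ) + 1) % ℓ) ∨
        (Odd (u.1 : ℕ) ∧ (v.2 : ℕ) = ((u.2 : ℕ) + 1) % ℓ))

/-! Upper bound: a level of the cylinder is an `ℓ`-tuple `A`, and a next level takes each entry from
the common neighbours of two cyclically consecutive entries of `A`. With `N` the square of the
adjacency matrix (the codegree matrix), adjacent level pairs number `tr (N ^ ℓ)` per parity
(`sum_levelAdj_card`). A next level that repeats a vertex or meets a small forbidden set has one
entry determined by the rest or by that set, so one codegree factor is lost; in total such bad pairs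
are at most a constant times the entry sum of `N ^ (ℓ - 1)`. The top eigenvalue of `N` is at least
its average row sum, hence at least `4e²/n²`, and this makes the trace dominate once `e²` exceeds a
constant times `n³` (`Matrix.IsHermitian.mul_sum_pow_le_trace`). Pruning then leaves a family in
which every level has a good successor, and the cylinder is built greedily. Lower bound: point-line
incidences of an affine plane contain no 4-cycle. -/

open Finset

/-! ### Pruning and counting of degenerate choices -/

/-- A finite symmetric relation whose number of related ordered pairs exceeds twice the total
weight has a nonempty part in which every degree exceeds the weight. -/
theorem exists_subset_weight_lt_degree {X : Type*} [DecidableEq X] (E : X → X → Prop)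
    [DecidableRel E] (hE : ∀ x y, E x y → E y x) (w : X → ℝ) (L : Finset X)
    (h : 2 * ∑ x ∈ L, w x < ∑ x ∈ L, (#{y ∈ L | E x y} : ℝ)) :
    ∃ L' : Finset X, L'.Nonempty ∧ ∀ x ∈ L', w x < #{y ∈ L' | E x y} := by
  induction L using Finset.strongInduction with
  | H L ih =>
    by_cases hL : ∀ x ∈ L, w x < #{y ∈ L | E x y}
    · refine ⟨L, ?_, hL⟩
      rw [nonempty_iff_ne_empty]
      rintro rfl
      simp at h
    · push Not at hL
      obtain ⟨x, hx, hxw⟩ := hL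
      -- Deleting `x` destroys at most `2 * w x` related ordered pairs, exactly what the right to
      -- delete its weight pays for.
      refine ih (L.erase x) (erase_ssubset hx) ?_
      have hdeg : ∀ a, (#{y ∈ L | E a y} : ℝ) =
          #{y ∈ L.erase x | E a y} + if E a x then 1 else 0 := by
        intro a
        simp only [card_filter, Nat.cast_sum, Nat.cast_ite, Nat.cast_one, Nat.cast_zero]
        rw [sum_erase_add _ _ hx]
      have hback : ∑ a ∈ L.erase x, (if E a x then (1 : ℝ) else 0) ≤ #{y ∈ L | E x y} := by
        simp only [card_filter, Nat.cast_sum, Nat.cast_ite, Nat.cast_one, Nat.cast_zero]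
        refine (sum_le_sum_of_subset_of_nonneg (erase_subset x L) ?_).trans (sum_le_sum ?_)
        · intros; positivity
        · intro a _
          by_cases hax : E a x
          · simp [hax, hE _ _ hax]
          · simp only [hax, if_false]; positivity
      rw [← sum_erase_add _ _ hx, ← sum_erase_add _ _ hx,
        sum_congr rfl (fun a _ => hdeg a), sum_add_distrib] at h
      linarith

/-- Choice functions whose `j`-th value is determined by the others are at most as many as the
choices of the others. -/
theorem card_le_prod_erase {ι V : Type*} [Fintype ι] [DecidableEq ι]
    (T : ι → Finset V) (j : ι) (P : Finset (ι → V)) (hP : ∀ B ∈ P, ∀ i, B i ∈ T i)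
    (hinj : ∀ B ∈ P, ∀ B' ∈ P, (∀ i ≠ j, B i = B' i) → B j = B' j) :
    #P ≤ ∏ i ∈ univ.erase j, #(T i) := by
  classical
  have hcard : #(Fintype.piFinset fun i : ↥(univ.erase j) => T i) =
      ∏ i ∈ univ.erase j, #(T i) := by
    rw [Fintype.card_piFinset]
    exact prod_coe_sort (univ.erase j) fun i => #(T i)
  rw [← hcard]
  refine card_le_card_of_injOn (fun B i => B i) ?_ ?_
  · intro B hB
    simp only [Fintype.coe_piFinset, Set.mem_pi, Set.mem_univ, true_imp_iff, mem_coe]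
    exact fun i => hP B hB i
  · intro B hB B' hB' h
    have hne : ∀ i ≠ j, B i = B' i := fun i hi =>
      congrFun h ⟨i, mem_erase.2 ⟨hi, mem_univ i⟩⟩
    funext i
    by_cases hi : i = j
    · subst hi
      exact hinj B hB B' hB' hne
    · exact hne i hi

/-- Few choice functions fail to be injective or meet a given small set. -/
theorem card_not_injective_or_meets_le {ι V : Type*} [Fintype ι] [DecidableEq ι]
    [DecidableEq V] (T : ι → Finset V) (S : Finset V) (P : Finset (ι → V))
    (hP : ∀ B ∈ P, ∀ i, B i ∈ T i)
    (hbad : ∀ B ∈ P, ¬(Function.Injective B ∧ ∀ j, B j ∉ S)) :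
    #P ≤ (#S + Fintype.card ι) * ∑ j, ∏ i ∈ univ.erase j, #(T i) := by
  -- A bad choice has a position `j` whose value is a given `s ∈ S` or copies another position;
  -- either way the other positions determine it.
  have hsub : P ⊆ univ.biUnion fun j =>
      (S.biUnion fun s => {B ∈ P | B j = s}) ∪
        (univ.erase j).biUnion fun i => {B ∈ P | B j = B i} := by
    intro B hB
    simp only [mem_biUnion, mem_univ, true_and, mem_union, mem_filter, mem_erase, and_true]
    by_contra! hcon
    refine hbad B hB ⟨fun i j hij => ?_, fun j hj => (hcon j).1 _ hj hB rfl⟩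
    by_contra hne
    exact (hcon i).2 j (Ne.symm hne) hB hij
  refine (card_le_card hsub).trans (card_biUnion_le.trans ?_)
  rw [mul_sum]
  refine sum_le_sum fun j _ => (card_union_le _ _).trans ?_
  rw [add_mul]
  refine Nat.add_le_add (card_biUnion_le.trans ?_) (card_biUnion_le.trans ?_)
  · rw [← smul_eq_mul]
    refine sum_le_card_nsmul _ _ _ fun s _ => card_le_prod_erase T j _ ?_ ?_
    · exact fun B hB => hP B (mem_filter.1 hB).1
    · intro B hB B' hB' _
      rw [(mem_filter.1 hB).2, (mem_filter.1 hB').2]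
  · refine (sum_le_card_nsmul _ _ (∏ i ∈ univ.erase j, #(T i)) fun s hs =>
      card_le_prod_erase T j _ ?_ ?_).trans ?_
    · exact fun B hB => hP B (mem_filter.1 hB).1
    · intro B hB B' hB' h
      rw [(mem_filter.1 hB).2, (mem_filter.1 hB').2]
      exact h s (mem_erase.1 hs).1
    · rw [smul_eq_mul]
      exact Nat.mul_le_mul_right _ (card_le_univ _)

/-! ### Cyclic products, traces and spectrum -/

/-- Products of matrix entries along tuples sum to entries of matrix powers. -/
theorem sum_prod_mul_eq_pow {V : Type*} [Fintype V] [DecidableEq V] (N : Matrix V V ℝ) (m : ℕ)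
    (h : V → V → ℝ) :
    ∑ A : Fin (m + 1) → V,
        (∏ i : Fin m, N (A i.castSucc) (A i.succ)) * h (A 0) (A (Fin.last m)) =
      ∑ x, ∑ y, (N ^ m) x y * h x y := by
  induction m generalizing h with
  | zero =>
    rw [← (Equiv.funUnique (Fin 1) V).symm.sum_comp]
    simp [Matrix.one_apply]
  | succ m ih =>
    rw [← (Fin.consEquiv fun _ => V).sum_comp, Fintype.sum_prod_type]
    refine sum_congr rfl fun x _ => ?_
    have := ih fun y z => N x y * h x z
    simp only [Fin.consEquiv_apply, Fin.prod_univ_succ, Fin.castSucc_zero, Fin.cons_zero,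
      Fin.cons_succ, Fin.castSucc_succ, ← Fin.succ_last]
    rw [sum_congr rfl fun A _ => show _ =
        (∏ i : Fin m, N (A i.castSucc) (A i.succ)) * (N x (A 0) * h x (A (Fin.last m))) by ring,
      this, sum_comm]
    refine sum_congr rfl fun z _ => ?_
    rw [pow_succ', Matrix.mul_apply, sum_mul]
    exact sum_congr rfl fun y _ => by ring

theorem sum_prod_cyclic_eq_trace {V : Type*} [Fintype V] [DecidableEq V] (N : Matrix V V ℝ)
    (m : ℕ) :
    ∑ A : Fin (m + 1) → V, ∏ i, N (A i) (A (i + 1)) = (N ^ (m + 1)).trace := by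
  have := sum_prod_mul_eq_pow N m fun x y => N y x
  simp only [Fin.prod_univ_castSucc, Fin.coeSucc_eq_succ, Fin.last_add_one]
  rw [this, pow_succ, Matrix.trace]
  exact sum_congr rfl fun x _ => by rw [Matrix.diag_apply, Matrix.mul_apply]

/-- Losing one factor opens the cycle into a path; rotating the indices moves the lost factor to the
end. -/
theorem sum_prod_cyclic_erase {V : Type*} [Fintype V] [DecidableEq V] (N : Matrix V V ℝ)
    (m : ℕ) (j : Fin (m + 1)) :
    ∑ A : Fin (m + 1) → V, ∏ i ∈ univ.erase j, N (A i) (A (i + 1)) =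
      ∑ x, ∑ y, (N ^ m) x y := by
  have hlast : ∑ A : Fin (m + 1) → V, ∏ i ∈ univ.erase (Fin.last m), N (A i) (A (i + 1)) =
      ∑ x, ∑ y, (N ^ m) x y := by
    have := sum_prod_mul_eq_pow N m fun _ _ => 1
    simp only [mul_one] at this
    rw [← this]
    refine sum_congr rfl fun A _ => ?_
    have herase : univ.erase (Fin.last m) = univ.map (Fin.castSuccEmb (n := m)) := by
      ext i
      simp only [mem_erase, mem_univ, and_true, mem_map, true_and, Fin.coe_castSuccEmb]
      exact Fin.exists_castSucc_eq.symm
    rw [herase, prod_map]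
    simp
  rw [← hlast, ← ((Equiv.addRight (j - Fin.last m)).arrowCongr (Equiv.refl V)).sum_comp]
  refine sum_congr rfl fun A _ => ?_
  refine prod_nbij' (fun i => i - (j - Fin.last m)) (fun i => i + (j - Fin.last m)) ?_ ?_ ?_ ?_ ?_
  · intro i hi
    simp only [mem_erase, mem_univ, and_true] at hi ⊢
    intro h
    exact hi (by rw [sub_eq_iff_eq_add] at h; rw [h]; abel)
  · intro i hi
    simp only [mem_erase, mem_univ, and_true] at hi ⊢
    intro h
    exact hi (by rw [← eq_sub_iff_add_eq] at h; rw [h]; abel)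
  · intro i _; abel
  · intro i _; abel
  · intro i _
    simp only [Equiv.arrowCongr_apply, Equiv.coe_refl, Function.comp_apply, id,
      Equiv.addRight_symm, Equiv.coe_addRight, ← sub_eq_add_neg]
    rw [show i + 1 - (j - Fin.last m) = i - (j - Fin.last m) + 1 by abel]

theorem Matrix.IsHermitian.exists_trace_pow_eq {V : Type*} [Fintype V] [DecidableEq V]
    {M : Matrix V V ℝ} (hM : M.IsHermitian) :
    ∃ e c : V → ℝ, (∀ m, (M ^ m).trace = ∑ i, e i ^ m) ∧
      ∀ m, ∑ x, ∑ y, (M ^ m) x y = ∑ i, e i ^ m * c i ^ 2 := by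
  set U : Matrix V V ℝ := (hM.eigenvectorUnitary : Matrix V V ℝ) with hU
  have hUU : star U * U = 1 := Unitary.coe_star_mul_self hM.eigenvectorUnitary
  have hUU' : U * star U = 1 := Unitary.coe_mul_star_self hM.eigenvectorUnitary
  have hspec : M = U * Matrix.diagonal hM.eigenvalues * star U := by
    conv_lhs => rw [hM.spectral_theorem, Unitary.conjStarAlgAut_apply]
    rfl
  have hpow : ∀ m, M ^ m = U * Matrix.diagonal (fun i => hM.eigenvalues i ^ m) * star U := by
    intro m
    induction m with
    | zero => simp [hUU']
    | succ m ih =>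
      rw [pow_succ, ih]
      nth_rw 2 [hspec]
      calc _ = U * Matrix.diagonal (fun i => hM.eigenvalues i ^ m) * (star U * U) *
            Matrix.diagonal hM.eigenvalues * star U := by simp only [mul_assoc]
        _ = _ := by
          rw [hUU, mul_one, mul_assoc U, Matrix.diagonal_mul_diagonal]
          simp only [pow_succ]
  -- The coefficient `c i` is the inner product of the `i`-th eigenvector with the all-ones vector.
  refine ⟨hM.eigenvalues, fun i => ∑ x, U x i, fun m => ?_, fun m => ?_⟩
  · rw [hpow, Matrix.trace_mul_comm, ← mul_assoc, hUU, one_mul, Matrix.trace_diagonal]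
  · have hentry : ∀ x y, (M ^ m) x y = ∑ i, hM.eigenvalues i ^ m * (U x i * U y i) := by
      intro x y
      rw [hpow, Matrix.mul_apply]
      refine sum_congr rfl fun i _ => ?_
      rw [Matrix.mul_diagonal, Matrix.star_apply, star_trivial]
      ring
    simp only [hentry]
    rw [sum_congr rfl fun x _ => sum_comm, sum_comm]
    refine sum_congr rfl fun i _ => ?_
    simp only [← mul_sum]
    rw [← sum_mul, sq]

/-- For the square `N` of a Hermitian matrix, a large entry sum forces the traces of the powers
of `N` to grow quickly compared with the entry sums. -/
theorem Matrix.IsHermitian.mul_sum_pow_le_trace {V : Type*} [Fintype V] [DecidableEq V]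
    {M : Matrix V V ℝ} (hM : M.IsHermitian) {D : ℝ} (hD : 0 < D) [Nonempty V]
    (h : D * Fintype.card V ≤ ∑ x, ∑ y, (M * M) x y) (m : ℕ) :
    0 < ((M * M) ^ (m + 1)).trace ∧
      D * ∑ x, ∑ y, ((M * M) ^ m) x y ≤ Fintype.card V * ((M * M) ^ (m + 1)).trace := by
  obtain ⟨e, c, htr, hsum⟩ := hM.exists_trace_pow_eq
  -- Maximising the square picks the top eigenvalue of `M * M`, whatever the sign of `e i₀`.
  obtain ⟨i₀, hi₀⟩ := Finite.exists_max fun i => e i ^ 2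
  have hMM : ∀ m, (M * M) ^ m = M ^ (2 * m) := fun m => by rw [pow_mul, pow_two]
  have hcard : ∑ i, c i ^ 2 = Fintype.card V := by
    have := hsum 0
    simp [Matrix.one_apply] at this
    rw [this]
  have hbound : ∀ m, ∑ x, ∑ y, ((M * M) ^ m) x y ≤ (e i₀ ^ 2) ^ m * Fintype.card V := by
    intro m
    rw [hMM, hsum, ← hcard, mul_sum]
    refine sum_le_sum fun i _ => ?_
    rw [pow_mul]
    exact mul_le_mul_of_nonneg_right (pow_le_pow_left₀ (sq_nonneg _) (hi₀ i) m) (sq_nonneg _)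
  have hDe : D ≤ e i₀ ^ 2 := by
    have h1 := hbound 1
    rw [pow_one, pow_one] at h1
    exact le_of_mul_le_mul_right (h.trans h1) (by exact_mod_cast Fintype.card_pos)
  have htrace : (e i₀ ^ 2) ^ (m + 1) ≤ ((M * M) ^ (m + 1)).trace := by
    rw [hMM, htr, ← pow_mul]
    exact single_le_sum (f := fun i => e i ^ (2 * (m + 1)))
      (fun i _ => by rw [pow_mul]; positivity) (mem_univ i₀)
  have hpos : 0 < e i₀ ^ 2 := hD.trans_le hDe
  refine ⟨(pow_pos hpos _).trans_le htrace, ?_⟩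
  calc D * ∑ x, ∑ y, ((M * M) ^ m) x y
      ≤ D * ((e i₀ ^ 2) ^ m * Fintype.card V) := by gcongr; exact hbound m
    _ ≤ e i₀ ^ 2 * ((e i₀ ^ 2) ^ m * Fintype.card V) := by gcongr
    _ = Fintype.card V * (e i₀ ^ 2) ^ (m + 1) := by ring
    _ ≤ _ := by gcongr

/-! ### Lower bound from affine planes -/

/-- The point-line incidence graph of the affine plane over `ZMod p` without vertical lines. -/
def affineIncidenceGraph (p : ℕ) : SimpleGraph ((ZMod p × ZMod p) ⊕ (ZMod p × ZMod p)) where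
  Adj
    | .inl P, .inr L => P.2 = L.1 * P.1 + L.2
    | .inr L, .inl P => P.2 = L.1 * P.1 + L.2
    | _, _ => False
  symm := ⟨by rintro (P | P) (Q | Q) h <;> exact h⟩
  loopless := ⟨by rintro (P | P) h <;> exact h⟩

/-- No two distinct vertices have two distinct common neighbours. -/
def SimpleGraph.NoQuadrilateral {V : Type*} (G : SimpleGraph V) : Prop :=
  ∀ a b c d, a ≠ c → b ≠ d → G.Adj a b → G.Adj b c → G.Adj c d → G.Adj d a → False

/-- The four incidences combine to `(m - m') * (x - x') = 0`. -/
theorem affineIncidence_unique {F : Type*} [Field F] {x y x' y' m b m' b' : F}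
    (h₁ : y = m * x + b) (h₂ : y = m' * x + b') (h₃ : y' = m * x' + b)
    (h₄ : y' = m' * x' + b') : (x, y) = (x', y') ∨ (m, b) = (m', b') := by
  have h : (m - m') * (x - x') = 0 := by linear_combination h₂ - h₁ + h₃ - h₄
  rcases mul_eq_zero.1 h with h | h
  · have hm : m = m' := sub_eq_zero.1 h
    subst hm
    right
    rw [Prod.mk.injEq]
    exact ⟨rfl, by linear_combination h₂ - h₁⟩
  · have hx : x = x' := sub_eq_zero.1 h
    subst hx
    left
    rw [Prod.mk.injEq]
    exact ⟨rfl, by linear_combination h₁ - h₃⟩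

theorem affineIncidenceGraph_noQuadrilateral (p : ℕ) [Fact p.Prime] :
    (affineIncidenceGraph p).NoQuadrilateral := by
  rintro (a | a) (b | b) (c | c) (d | d) hac hbd h₁ h₂ h₃ h₄ <;>
    simp only [affineIncidenceGraph] at h₁ h₂ h₃ h₄
  · rcases affineIncidence_unique h₁ h₄ h₂ h₃ with h | h
    · exact hac (congrArg _ h)
    · exact hbd (congrArg _ h)
  · rcases affineIncidence_unique h₁ h₂ h₄ h₃ with h | h
    · exact hbd (congrArg _ h)
    · exact hac (congrArg _ h)

theorem SimpleGraph.NoQuadrilateral.map {V W : Type*} {G : SimpleGraph V}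
    (hG : G.NoQuadrilateral) (f : V ↪ W) : (G.map f).NoQuadrilateral := by
  intro a b c d hac hbd h₁ h₂ h₃ h₄
  rw [SimpleGraph.map_adj] at h₁ h₂ h₃ h₄
  obtain ⟨a, b, h₁, rfl, rfl⟩ := h₁
  obtain ⟨b', c, h₂, hb, rfl⟩ := h₂
  obtain ⟨c', d, h₃, hc, rfl⟩ := h₃
  obtain ⟨d', a', h₄, hd, ha⟩ := h₄
  obtain rfl := f.injective hb
  obtain rfl := f.injective hc
  obtain rfl := f.injective hd
  obtain rfl := f.injective ha
  exact hG _ _ _ _ (fun h => hac (congrArg f h)) (fun h => hbd (congrArg f h)) h₁ h₂ h₃ h₄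

/-- An abscissa, a slope and an intercept can be chosen freely and determine an incidence. -/
theorem le_card_edgeFinset_affineIncidenceGraph (p : ℕ) [NeZero p]
    [DecidableRel (affineIncidenceGraph p).Adj] :
    p ^ 3 ≤ #(affineIncidenceGraph p).edgeFinset := by
  have hcard : #(univ : Finset (ZMod p × ZMod p × ZMod p)) = p ^ 3 := by
    simp [ZMod.card]; ring
  rw [← hcard]
  refine card_le_card_of_injOn
    (fun t => s(.inl (t.1, t.2.1 * t.1 + t.2.2), .inr (t.2.1, t.2.2))) ?_ ?_
  · intro t _
    simp only [mem_coe, SimpleGraph.mem_edgeFinset, SimpleGraph.mem_edgeSet]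
    exact rfl
  · rintro ⟨x, m, b⟩ _ ⟨x', m', b'⟩ _ h
    simp at h
    grind

theorem quadCylinder_adj_of {k ℓ : ℕ} {u v : Fin k × Fin ℓ} (h : (v.1 : ℕ) = (u.1 : ℕ) + 1)
    (h' : u.2 = v.2 ∨
        (Even (u.1 : ℕ) ∧ (u.2 : ℕ) = ((v.2 : ℕ) + 1) % ℓ) ∨
        (Odd (u.1 : ℕ) ∧ (v.2 : ℕ) = ((u.2 : ℕ) + 1) % ℓ)) : (quadCylinder k ℓ).Adj u v := by
  rw [quadCylinder, SimpleGraph.fromRel_adj]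
  refine ⟨?_, Or.inl ⟨h, h'⟩⟩
  rintro rfl
  omega

theorem SimpleGraph.NoQuadrilateral.quadCylinder_free {V : Type*} {G : SimpleGraph V}
    (hG : G.NoQuadrilateral) {k ℓ : ℕ} (hℓ : 2 ≤ ℓ) (hk : 3 ≤ k ∨ (k = 2 ∧ ℓ = 2)) :
    (quadCylinder k ℓ).Free G := by
  rintro ⟨f⟩
  have key : ∀ a b c d : Fin k × Fin ℓ, a ≠ c → b ≠ d → (quadCylinder k ℓ).Adj a b →
      (quadCylinder k ℓ).Adj b c → (quadCylinder k ℓ).Adj c d → (quadCylinder k ℓ).Adj d a →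
      False := fun a b c d hac hbd h₁ h₂ h₃ h₄ =>
    hG _ _ _ _ (fun h => hac (f.injective h)) (fun h => hbd (f.injective h))
      (f.toHom.map_adj h₁) (f.toHom.map_adj h₂) (f.toHom.map_adj h₃) (f.toHom.map_adj h₄)
  have h1 : 1 % ℓ = 1 := Nat.mod_eq_of_lt hℓ
  rcases hk with hk | ⟨rfl, rfl⟩
  · refine key (⟨0, by omega⟩, ⟨1, by omega⟩) (⟨1, by omega⟩, ⟨0, by omega⟩)
      (⟨2, by omega⟩, ⟨1, by omega⟩) (⟨1, by omega⟩, ⟨1, by omega⟩) (by simp) (by simp) ?_ ?_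
      (SimpleGraph.Adj.symm ?_) (SimpleGraph.Adj.symm ?_) <;>
    exact quadCylinder_adj_of (by simp) (by simp [h1])
  · refine key (0, 0) (1, 0) (0, 1) (1, 1) (by simp) (by simp) ?_
      (SimpleGraph.Adj.symm ?_) ?_ (SimpleGraph.Adj.symm ?_) <;>
    exact quadCylinder_adj_of (by simp) (by simp)

theorem rpow_le_extremalNumber_quadCylinder {k ℓ : ℕ} (hℓ : 2 ≤ ℓ)
    (hk : 3 ≤ k ∨ (k = 2 ∧ ℓ = 2)) {n : ℕ} (hn : 8 ≤ n) :
    (n : ℝ) ^ (3 / 2 : ℝ) ≤ 27 * SimpleGraph.extremalNumber n (quadCylinder k ℓ) := by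
  classical
  -- Bertrand's prime in `(N, 2N]` satisfies `2p² ≤ n ≤ 8p²`; then `n ≤ (3p)²` yields the constant
  -- 27.
  set N := Nat.sqrt (n / 8) with hN
  have hN1 : 1 ≤ N := by rw [hN, Nat.le_sqrt]; omega
  obtain ⟨p, hp, hNp, hpN⟩ := Nat.exists_prime_lt_and_le_two_mul N (by omega)
  have : Fact p.Prime := ⟨hp⟩
  have hupper : 2 * (p * p) ≤ n := by
    have h1 : N * N ≤ n / 8 := Nat.sqrt_le _
    have h2 : p * p ≤ 2 * N * (2 * N) := Nat.mul_le_mul hpN hpN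
    have h3 : 2 * N * (2 * N) = 4 * (N * N) := by ring
    omega
  have hlower : n ≤ 8 * (p * p) := by
    have h1 : n / 8 < (N + 1) * (N + 1) := Nat.lt_succ_sqrt _
    have h2 : (N + 1) * (N + 1) ≤ p * p := Nat.mul_le_mul hNp hNp
    omega
  obtain ⟨f⟩ : Nonempty ((ZMod p × ZMod p) ⊕ (ZMod p × ZMod p) ↪ Fin n) := by
    refine Function.Embedding.nonempty_of_card_le ?_
    simp only [Fintype.card_sum, Fintype.card_prod, ZMod.card, Fintype.card_fin]
    omega
  have hfree : (quadCylinder k ℓ).Free ((affineIncidenceGraph p).map f) :=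
    ((affineIncidenceGraph_noQuadrilateral p).map f).quadCylinder_free hℓ hk
  have hex := SimpleGraph.card_edgeFinset_le_extremalNumber hfree
  rw [Fintype.card_fin] at hex
  have hedge : p ^ 3 ≤ SimpleGraph.extremalNumber n (quadCylinder k ℓ) := by
    refine (le_card_edgeFinset_affineIncidenceGraph p).trans (le_trans (le_of_eq ?_) hex)
    rw [← SimpleGraph.card_edgeFinset_map f]
  calc (n : ℝ) ^ (3 / 2 : ℝ) ≤ ((3 * p : ℝ) ^ (2 : ℝ)) ^ (3 / 2 : ℝ) := by
        gcongr
        have : (n : ℝ) ≤ 8 * (p * p) := by exact_mod_cast hlower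
        rw [Real.rpow_two]
        nlinarith [sq_nonneg (p : ℝ)]
    _ = 27 * (p : ℝ) ^ 3 := by
        rw [← Real.rpow_mul (by positivity)]
        norm_num
        norm_cast
        ring
    _ ≤ _ := by
        gcongr
        exact_mod_cast hedge

/-! ### Upper bound by counting levels -/

/-- The entry sum counts two-step walks, so it is the sum of squared degrees; Cauchy–Schwarz
applies. -/
theorem four_mul_sq_card_edgeFinset_le {V : Type*} [Fintype V] (G : SimpleGraph V)
    [DecidableRel G.Adj] :
    4 * (#G.edgeFinset : ℝ) ^ 2 ≤
      Fintype.card V * ∑ x, ∑ y, (G.adjMatrix ℝ * G.adjMatrix ℝ) x y := by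
  have hsum : ∑ x, ∑ y, (G.adjMatrix ℝ * G.adjMatrix ℝ) x y = ∑ z, (G.degree z : ℝ) ^ 2 := by
    simp only [Matrix.mul_apply]
    rw [sum_congr rfl fun x _ => sum_comm, sum_comm]
    refine sum_congr rfl fun z _ => ?_
    rw [← sum_mul_sum, sq]
    congr 1
    · simp only [SimpleGraph.adjMatrix_apply, G.adj_comm _ z, sum_boole,
        ← SimpleGraph.card_neighborFinset_eq_degree, SimpleGraph.neighborFinset_eq_filter]
    · simp only [SimpleGraph.adjMatrix_apply, sum_boole,
        ← SimpleGraph.card_neighborFinset_eq_degree, SimpleGraph.neighborFinset_eq_filter]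
  have hdeg : ∑ z, (G.degree z : ℝ) = 2 * #G.edgeFinset := by
    exact_mod_cast G.sum_degrees_eq_twice_card_edges
  have := sq_sum_le_card_mul_sum_sq (s := univ) (f := fun z => (G.degree z : ℝ))
  rw [hdeg, card_univ, ← hsum] at this
  linarith

section CylinderLevels

variable {V : Type*} [Fintype V] [DecidableEq V] (G : SimpleGraph V) [DecidableRel G.Adj]

/-- The admissible values in position `j` of a level of the cylinder next to the level `A`;
the Boolean tells whether `A` plays the role of an even level. -/
def levelChoices {m : ℕ} (s : Bool) (A : Fin (m + 1) → V) (j : Fin (m + 1)) : Finset V :=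
  if s then G.neighborFinset (A j) ∩ G.neighborFinset (A (j + 1))
  else G.neighborFinset (A (j - 1)) ∩ G.neighborFinset (A j)

/-- Consecutive levels of the cylinder, labelled by their parities. -/
def LevelAdj {m : ℕ} (x y : Bool × (Fin (m + 1) → V)) : Prop :=
  y.1 = !x.1 ∧ ∀ j, y.2 j ∈ levelChoices G x.1 x.2 j

variable {G}

theorem mem_levelChoices_true {m : ℕ} {A : Fin (m + 1) → V} {j : Fin (m + 1)} {v : V} :
    v ∈ levelChoices G true A j ↔ G.Adj (A j) v ∧ G.Adj (A (j + 1)) v := by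
  simp [levelChoices]

theorem mem_levelChoices_false {m : ℕ} {A : Fin (m + 1) → V} {j : Fin (m + 1)} {v : V} :
    v ∈ levelChoices G false A j ↔ G.Adj (A (j - 1)) v ∧ G.Adj (A j) v := by
  simp [levelChoices]

theorem LevelAdj.symm {m : ℕ} {x y : Bool × (Fin (m + 1) → V)} (h : LevelAdj G x y) :
    LevelAdj G y x := by
  obtain ⟨s, A⟩ := x
  obtain ⟨t, B⟩ := y
  obtain ⟨h, hAB⟩ := h
  cases s <;> simp only [Bool.not_true, Bool.not_false] at h <;> subst h <;> refine ⟨rfl, fun j => ?_⟩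
  · simp only [mem_levelChoices_false, mem_levelChoices_true] at hAB ⊢
    have := (hAB (j + 1)).1
    rw [add_sub_cancel_right] at this
    exact ⟨(hAB j).2.symm, this.symm⟩
  · simp only [mem_levelChoices_false, mem_levelChoices_true] at hAB ⊢
    have := (hAB (j - 1)).2
    rw [sub_add_cancel] at this
    exact ⟨this.symm, (hAB j).1.symm⟩

theorem levelChoices_false_shift {m : ℕ} (A : Fin (m + 1) → V) (j : Fin (m + 1)) :
    levelChoices G false (fun i => A (i + 1)) j = levelChoices G true A j := by
  ext v
  rw [mem_levelChoices_false, mem_levelChoices_true, sub_add_cancel]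

/-- Rotating the tuple by one position exchanges the two parity rules. -/
theorem sum_levelChoices_false {m : ℕ} (f : (Fin (m + 1) → Finset V) → ℝ) :
    ∑ A : Fin (m + 1) → V, f (levelChoices G false A) =
      ∑ A : Fin (m + 1) → V, f (levelChoices G true A) := by
  rw [← ((Equiv.addRight (-1 : Fin (m + 1))).arrowCongr (Equiv.refl V)).sum_comp]
  refine sum_congr rfl fun A _ => congrArg f (funext fun j => ?_)
  rw [← levelChoices_false_shift]
  congr 1
  funext i
  simp

theorem card_levelChoices_true {m : ℕ} (A : Fin (m + 1) → V) (j : Fin (m + 1)) :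
    (#(levelChoices G true A j) : ℝ) =
      (G.adjMatrix ℝ * G.adjMatrix ℝ) (A j) (A (j + 1)) := by
  rw [SimpleGraph.adjMatrix_mul_apply]
  simp only [SimpleGraph.adjMatrix_apply, sum_boole, levelChoices, if_true]
  congr 2
  ext v
  simp [G.adj_comm]

theorem sum_levelAdj_card {m : ℕ} [DecidableRel (LevelAdj G (m := m))] :
    ∑ x : Bool × (Fin (m + 1) → V), (#{y | LevelAdj G x y} : ℝ) =
      2 * ((G.adjMatrix ℝ * G.adjMatrix ℝ) ^ (m + 1)).trace := by
  have hcard : ∀ x : Bool × (Fin (m + 1) → V),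
      (#{y | LevelAdj G x y} : ℝ) = ∏ j, (#(levelChoices G x.1 x.2 j) : ℝ) := by
    intro x
    have : ({y | LevelAdj G x y} : Finset (Bool × (Fin (m + 1) → V))) =
        {!x.1} ×ˢ Fintype.piFinset (levelChoices G x.1 x.2) := by
      ext y
      simp only [mem_filter, mem_univ, true_and, mem_product, mem_singleton,
        Fintype.mem_piFinset]
      rfl
    rw [this, card_product, card_singleton, one_mul, Fintype.card_piFinset, Nat.cast_prod]
  rw [sum_congr rfl fun x _ => hcard x, Fintype.sum_prod_type, Fintype.sum_bool,
    sum_levelChoices_false fun T => ∏ j, (#(T j) : ℝ), ← sum_prod_cyclic_eq_trace, ← two_mul]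
  simp only [card_levelChoices_true]

theorem sum_prod_erase_levelChoices (m : ℕ) :
    ∑ x : Bool × (Fin (m + 1) → V),
        ∑ j, ∏ i ∈ univ.erase j, (#(levelChoices G x.1 x.2 i) : ℝ) =
      2 * ((m + 1) * ∑ x, ∑ y, ((G.adjMatrix ℝ * G.adjMatrix ℝ) ^ m) x y) := by
  rw [Fintype.sum_prod_type, Fintype.sum_bool,
    sum_levelChoices_false fun T => ∑ j, ∏ i ∈ univ.erase j, (#(T i) : ℝ), ← two_mul, sum_comm]
  simp only [card_levelChoices_true, sum_prod_cyclic_erase]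
  simp

/-- If `G` has many closed walks compared with walks two steps shorter, there is a family of
levels in which every level can be followed by one that avoids a prescribed small set. -/
theorem exists_levels {m : ℕ} (K : ℕ)
    (h : 2 * (K + (m + 1)) * (m + 1) *
        ∑ x, ∑ y, ((G.adjMatrix ℝ * G.adjMatrix ℝ) ^ m) x y <
      ((G.adjMatrix ℝ * G.adjMatrix ℝ) ^ (m + 1)).trace) :
    ∃ L : Finset (Bool × (Fin (m + 1) → V)), L.Nonempty ∧ ∀ x ∈ L, ∀ S : Finset V, #S ≤ K →
      ∃ y ∈ L, LevelAdj G x y ∧ Function.Injective y.2 ∧ ∀ j, y.2 j ∉ S := by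
  classical
  obtain ⟨L, hL, hdeg⟩ := exists_subset_weight_lt_degree (LevelAdj G (m := m))
    (fun _ _ h => h.symm)
    -- The weight bounds the number of bad successors of `x`, so a larger degree forces a good one.
    (fun x => (K + (m + 1)) * ∑ j, ∏ i ∈ univ.erase j, (#(levelChoices G x.1 x.2 i) : ℝ))
    univ (by
      rw [sum_levelAdj_card, ← mul_sum, sum_prod_erase_levelChoices]
      linarith)
  refine ⟨L, hL, fun x hx S hS => ?_⟩
  by_contra! hcon
  have hinj : Set.InjOn Prod.snd (L.filter (LevelAdj G x) : Set (Bool × (Fin (m + 1) → V))) := by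
    rintro ⟨s, A⟩ hy ⟨t, B⟩ hz hAB
    simp only [coe_filter, Set.mem_ofPred_eq, LevelAdj] at hy hz
    exact Prod.ext (hy.2.1.trans hz.2.1.symm) hAB
  have hle := card_not_injective_or_meets_le (levelChoices G x.1 x.2) S
    (({y ∈ L | LevelAdj G x y}).image Prod.snd) (by
      intro B hB
      obtain ⟨y, hy, rfl⟩ := mem_image.1 hB
      exact (mem_filter.1 hy).2.2) (by
      intro B hB
      obtain ⟨y, hy, rfl⟩ := mem_image.1 hB
      rintro ⟨hBi, hBS⟩
      obtain ⟨j, hj⟩ := hcon y (mem_filter.1 hy).1 (mem_filter.1 hy).2 hBi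
      exact hBS j hj)
  rw [card_image_of_injOn hinj, Fintype.card_fin] at hle
  have hlt := hdeg x hx
  have hle' : (#{y ∈ L | LevelAdj G x y} : ℝ) ≤
      (#S + (m + 1)) * ∑ j, ∏ i ∈ univ.erase j, (#(levelChoices G x.1 x.2 i) : ℝ) := by
    exact_mod_cast hle
  refine absurd (hlt.trans_le hle') (not_lt.2 ?_)
  gcongr

/-- Following levels greedily gives arbitrarily long sequences of pairwise disjoint levels. -/
theorem exists_level_sequence {m k : ℕ} {L : Finset (Bool × (Fin (m + 1) → V))}
    (hL : L.Nonempty)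
    (hstep : ∀ x ∈ L, ∀ S : Finset V, #S ≤ k * (m + 1) →
      ∃ y ∈ L, LevelAdj G x y ∧ Function.Injective y.2 ∧ ∀ j, y.2 j ∉ S) {r : ℕ} (hr : r ≤ k) :
    ∃ Y : ℕ → Fin (m + 1) → V,
      (∀ i, i < r → (decide (Even i), Y i) ∈ L) ∧
      (∀ i, i + 1 < r → LevelAdj G (decide (Even i), Y i) (decide (Even (i + 1)), Y (i + 1))) ∧
      ∀ i, i < r → ∀ i', i' < r → ∀ j j', Y i j = Y i' j' → i = i' ∧ j = j' := by
  induction r with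
  | zero =>
    obtain ⟨x, -⟩ := hL
    exact ⟨fun _ => x.2, by simp⟩
  | succ r ih =>
    obtain ⟨Y, hYL, hYadj, hYinj⟩ := ih (by omega)
    set S : Finset V := (range r ×ˢ univ).image fun p : ℕ × Fin (m + 1) => Y p.1 p.2 with hS
    have hScard : #S ≤ k * (m + 1) := by
      refine card_image_le.trans ?_
      rw [card_product, card_range, card_univ, Fintype.card_fin]
      exact Nat.mul_le_mul_right _ (by omega)
    have hYS : ∀ i, i < r → ∀ j, Y i j ∈ S := fun i hi j =>
      mem_image.2 ⟨(i, j), by simp [hi], rfl⟩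
    obtain ⟨Z, hZL, hZadj, hZinj, hZS⟩ : ∃ Z : Fin (m + 1) → V, (decide (Even r), Z) ∈ L ∧
        (∀ i, i + 1 = r → LevelAdj G (decide (Even i), Y i) (decide (Even r), Z)) ∧
        Function.Injective Z ∧ ∀ j, Z j ∉ S := by
      rcases r with - | r
      -- The start must be injective and of parity `true`. Two steps inside `L` reach both parities
      -- by injective levels.
      · obtain ⟨⟨s, A⟩, hx⟩ := hL
        obtain ⟨⟨t, B⟩, hyL, hy, hyi, hyS⟩ := hstep _ hx S hScard
        obtain ⟨⟨u, C⟩, hzL, hz, hzi, hzS⟩ := hstep _ hyL S hScard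
        cases t
        · obtain rfl : u = true := hz.1
          exact ⟨C, by simpa using hzL, by simp, hzi, hzS⟩
        · exact ⟨B, by simpa using hyL, by simp, hyi, hyS⟩
      · obtain ⟨⟨t, B⟩, hyL, hy, hyi, hyS⟩ := hstep _ (hYL r (by omega)) S hScard
        have ht : t = decide (Even (r + 1)) := by
          rw [show t = !decide (Even r) from hy.1]
          by_cases hr' : Even r <;> simp [Nat.even_add_one, hr']
        subst ht
        refine ⟨B, hyL, ?_, hyi, hyS⟩
        intro i hi
        obtain rfl : i = r := by omega
        exact hy
    refine ⟨Function.update Y r Z, ?_, ?_, ?_⟩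
    · intro i hi
      rcases Nat.lt_succ_iff_lt_or_eq.1 hi with hi | rfl
      · rw [Function.update_of_ne hi.ne]
        exact hYL i hi
      · rwa [Function.update_self]
    · intro i hi
      rw [Function.update_of_ne (show i ≠ r by omega)]
      rcases Nat.lt_succ_iff_lt_or_eq.1 hi with hi | rfl
      · rw [Function.update_of_ne hi.ne]
        exact hYadj i hi
      · rw [Function.update_self]
        exact hZadj i rfl
    · intro i hi i' hi' j j' h
      rcases Nat.lt_succ_iff_lt_or_eq.1 hi with hi | rfl <;>
        rcases Nat.lt_succ_iff_lt_or_eq.1 hi' with hi' | rfl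
      · rw [Function.update_of_ne hi.ne, Function.update_of_ne hi'.ne] at h
        exact hYinj i hi i' hi' j j' h
      · rw [Function.update_of_ne hi.ne, Function.update_self] at h
        exact absurd (h ▸ hYS i hi j) (hZS j')
      · rw [Function.update_of_ne hi'.ne, Function.update_self] at h
        exact absurd (h ▸ hYS i' hi' j') (hZS j)
      · rw [Function.update_self] at h
        exact ⟨rfl, hZinj h⟩

theorem quadCylinder_isContained_of_levels {m k : ℕ} {L : Finset (Bool × (Fin (m + 1) → V))}
    (hL : L.Nonempty)
    (hstep : ∀ x ∈ L, ∀ S : Finset V, #S ≤ k * (m + 1) →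
      ∃ y ∈ L, LevelAdj G x y ∧ Function.Injective y.2 ∧ ∀ j, y.2 j ∉ S) :
    (quadCylinder k (m + 1)).IsContained G := by
  obtain ⟨Y, -, hadj, hinj⟩ := exists_level_sequence hL hstep le_rfl
  have hsucc : ∀ a b : Fin (m + 1), (a : ℕ) = ((b : ℕ) + 1) % (m + 1) → a = b + 1 := by
    intro a b h
    apply Fin.ext
    rw [h, Fin.val_add]
    simp
  have hrel : ∀ u v : Fin k × Fin (m + 1), (v.1 : ℕ) = (u.1 : ℕ) + 1 ∧
      (u.2 = v.2 ∨
        (Even (u.1 : ℕ) ∧ (u.2 : ℕ) = ((v.2 : ℕ) + 1) % (m + 1)) ∨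
        (Odd (u.1 : ℕ) ∧ (v.2 : ℕ) = ((u.2 : ℕ) + 1) % (m + 1))) →
      G.Adj (Y u.1 u.2) (Y v.1 v.2) := by
    rintro ⟨i, j⟩ ⟨i', j'⟩ ⟨hi, h⟩
    simp only at hi h ⊢
    have hA := (hadj i (by rw [← hi]; exact i'.2)).2
    rw [hi]
    simp only at hA
    by_cases hev : Even (i : ℕ)
    · simp only [hev, decide_true, mem_levelChoices_true] at hA
      rcases h with rfl | ⟨-, h⟩ | ⟨hodd, -⟩
      · exact (hA j).1
      · rw [hsucc _ _ h]
        exact (hA j').2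
      · exact absurd hev (Nat.not_even_iff_odd.2 hodd)
    · simp only [hev, decide_false, mem_levelChoices_false] at hA
      rcases h with rfl | ⟨hev', -⟩ | ⟨-, h⟩
      · exact (hA j).2
      · exact absurd hev' hev
      · rw [hsucc _ _ h]
        have := (hA (j + 1)).1
        rwa [add_sub_cancel_right] at this
  refine ⟨⟨⟨fun u => Y u.1 u.2, ?_⟩, ?_⟩⟩
  · intro u v huv
    rw [quadCylinder, SimpleGraph.fromRel_adj] at huv
    rcases huv.2 with h | h
    · exact hrel u v h
    · exact (hrel v u h).symm
  · intro u v huv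
    obtain ⟨h1, h2⟩ := hinj u.1 u.1.2 v.1 v.1.2 u.2 v.2 huv
    exact Prod.ext (Fin.ext h1) h2

theorem quadCylinder_isContained_of_lt {m k : ℕ}
    (h : (k * (m + 1) + (m + 1)) * (m + 1) * (Fintype.card V : ℝ) ^ 3 < (#G.edgeFinset : ℝ) ^ 2) :
    (quadCylinder k (m + 1)).IsContained G := by
  have hepos : (0 : ℝ) < (#G.edgeFinset : ℝ) ^ 2 := lt_of_le_of_lt (by positivity) h
  have hV : Nonempty V := by
    by_contra hV
    rw [not_nonempty_iff] at hV
    have hE : #G.edgeFinset = 0 := by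
      rw [card_eq_zero, eq_empty_iff_forall_notMem]
      exact fun e _ => e.inductionOn fun v _ => hV.elim v
    simp [hE] at hepos
  have hn : (0 : ℝ) < Fintype.card V := by exact_mod_cast Fintype.card_pos
  obtain ⟨hpos, hle⟩ := Matrix.IsHermitian.mul_sum_pow_le_trace
    (M := G.adjMatrix ℝ) (by rw [Matrix.IsHermitian, Matrix.conjTranspose_eq_transpose_of_trivial,
      SimpleGraph.transpose_adjMatrix])
    -- This is the lower bound on the average row sum of the codegree matrix.
    (D := 4 * (#G.edgeFinset : ℝ) ^ 2 / (Fintype.card V : ℝ) ^ 2) (by positivity) (by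
      have := four_mul_sq_card_edgeFinset_le G
      rw [div_mul_eq_mul_div, div_le_iff₀ (by positivity)]
      nlinarith) m
  obtain ⟨L, hL, hstep⟩ := exists_levels (G := G) (m := m) (k * (m + 1)) (by
    push_cast
    set T := ((G.adjMatrix ℝ * G.adjMatrix ℝ) ^ (m + 1)).trace
    set W := ∑ x, ∑ y, ((G.adjMatrix ℝ * G.adjMatrix ℝ) ^ m) x y
    -- If `W ≤ 0`, positivity of the trace suffices; otherwise `W` can be cancelled after comparing
    -- `D` with the constant times `n`.
    rcases le_or_gt W 0 with hW | hW
    · exact (mul_nonpos_of_nonneg_of_nonpos (by positivity) hW).trans_lt hpos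
    · refine lt_of_mul_lt_mul_left (lt_of_lt_of_le ?_ hle) hn.le
      rw [← mul_assoc]
      gcongr
      rw [lt_div_iff₀ (by positivity)]
      nlinarith)
  exact quadCylinder_isContained_of_levels hL hstep

end CylinderLevels

/-! ### Asymptotic conclusions -/

theorem extremalNumber_quadCylinder_le (k m n : ℕ) :
    (SimpleGraph.extremalNumber n (quadCylinder k (m + 1)) : ℝ) ≤
      √((k * (m + 1) + (m + 1)) * (m + 1)) * (n : ℝ) ^ (3 / 2 : ℝ) := by
  rw [← Fintype.card_fin n, SimpleGraph.extremalNumber_le_iff_of_nonneg _ (by positivity)]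
  intro G _ hG
  by_contra! hlt
  refine hG (quadCylinder_isContained_of_lt ?_)
  have hsq := pow_lt_pow_left₀ hlt (by positivity) two_ne_zero
  rw [mul_pow, Real.sq_sqrt (by positivity), ← Real.rpow_natCast ((_ : ℝ) ^ (3 / 2 : ℝ)),
    ← Real.rpow_mul (by positivity)] at hsq
  norm_num at hsq ⊢
  exact_mod_cast hsq

theorem theorem4 (k ℓ : ℕ) (hk : 1 ≤ k) (hℓ : 1 ≤ ℓ) :
    ((fun n : ℕ => (SimpleGraph.extremalNumber n (quadCylinder k ℓ) : ℝ))
        =O[Filter.atTop] fun n : ℕ => (n : ℝ) ^ (3 / 2 : ℝ)) ∧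
      (2 ≤ ℓ → (3 ≤ k ∨ (k = 2 ∧ ℓ = 2)) →
        (fun n : ℕ => (SimpleGraph.extremalNumber n (quadCylinder k ℓ) : ℝ))
          =Θ[Filter.atTop] fun n : ℕ => (n : ℝ) ^ (3 / 2 : ℝ)) := by
  have hO : (fun n : ℕ => (SimpleGraph.extremalNumber n (quadCylinder k ℓ) : ℝ))
      =O[Filter.atTop] fun n : ℕ => (n : ℝ) ^ (3 / 2 : ℝ) := by
    obtain ⟨m, rfl⟩ := Nat.exists_eq_add_of_le' hℓ
    refine Asymptotics.IsBigO.of_bound √((k * (m + 1) + (m + 1)) * (m + 1))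
      (Filter.Eventually.of_forall fun n => ?_)
    rw [Real.norm_of_nonneg (by positivity), Real.norm_of_nonneg (by positivity)]
    exact extremalNumber_quadCylinder_le k m n
  refine ⟨hO, fun hℓ' hk' => ⟨hO, Asymptotics.IsBigO.of_bound 27 ?_⟩⟩
  filter_upwards [Filter.eventually_ge_atTop 8] with n hn
  rw [Real.norm_of_nonneg (by positivity), Real.norm_of_nonneg (by positivity)]
  exact rpow_le_extremalNumber_quadCylinder hℓ' hk' hn
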